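/- **Setting.** Let $\mathcal A$ be a set of agents, $\mathcal I$ a set of institutions and $\mathcal X$ a finite set of contracts, each of which involves one agent $\alpha(x)\in\mathcal A$ and one institution in $\mathcal I$. For $X\subseteq\mathcal X$ let $X_a$ and $X_i$ be the sets of contracts in $X$ that involve agent $a$, respectively institution $i$. A *choice rule* for $i$ is a map $C_i:2^{\mathcal X_i}\to 2^{\mathcal X_i}$ with $C_i(Y)\subseteq Y$. It is *path independent* if $C_i(Y\cup Z)=C_i(C_i(Y)\cup Z)$ for all $Y,Z\subseteq \mathcal X_i$, and *size monotonic* if $|C_i(Y)|\le |C_i(Z)|$ whenever $Y\subseteq Z\subseteq\mathcal X_i$. A *punctual choice axiom* for $i$ is a correspondence $\phi_i$ assigning to each $Y\subseteq\mathcal X_i$ a (possibly empty) collection $\phi_i(Y)\subseteq 2^{Y}$; $C_i$ satisfies $\phi_i$ if $C_i(Y)\in\phi_i(Y)$ for all $Y\subseteq\mathcal X_i$. A *matching* is a set $X\subseteq\mathcal X$ with $|X_a|\le 1$ for every agent $a$; we identify $X_a$ with its only element, or with the null contract $\emptyset$ if it is empty. A *problem* is a profile $R=(R_a)_{a\in\mathcal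 A}$ of linear orders $R_a$ over $\mathcal X_a\cup\{\emptyset\}$, and a *matching rule* $\varphi$ assigns a matching $\varphi(R)$ to each problem $R$. The rule $\varphi$ is *individually rational* if $\varphi_a(R)\mathrel{R_a}\emptyset$ for all $R$ and $a$, and *strategy-proof* if $\varphi_a(R)\mathrel{R_a}\varphi_a(R'_a,R_{-a})$ for all $R$, $a$ and $R'_a$. The *demand* for $i$ at a matching $X$ under $R$ is $D_i(X)=\{x\in\mathcal X_i : x\mathrel{R_{\alpha(x)}}X_{\alpha(x)}\}$; $\varphi$ satisfies the *extension* $\overline\phi_i$ of $\phi_i$ if for every problem $R$ the matching $X=\varphi(R)$ satisfies $X_i\in\phi_i(D_i(X))$. The *deferred-acceptance (DA) rule based on* $C=(C_i)_{i\in\mathcal I}$ selects, at each problem, the outcome of the following algorithm. At step 1 each agent proposes her most preferred acceptable contract, if any (a contract $x$ of $a$ is acceptable if $x\mathrel{R_a}\emptyset$). At each later step, each agent whose contract was rejected at the previous step proposes her next most preferred acceptable contract, if any. At each step, each institution $i$ considers the set $Y$ of its tentatively held contracts together with the new proposals to it, tentatively holds $C_i(Y)$ and permanently rejects $Y\setminus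 C_i(Y)$. The algorithm stops at the first step without a rejection, and the contracts held then form the outcome. **Theorem.** For each institution $i\in\mathcal I$ let $C_i$ be a choice rule and $\Phi_i$ a set of punctual choice axioms for $i$ such that $C_i$ is the unique choice rule for $i$ that satisfies all axioms in $\Phi_i$. Suppose that every $C_i$ is path independent and size monotonic. Then a matching rule is individually rational, strategy-proof, and satisfies the extensions $\overline\phi_i$ for all $i\in\mathcal I$ and $\phi_i\in\Phi_i$ if and only if it is the deferred-acceptance rule based on $C=(C_i)_{i\in\mathcal I}$. -/

import Mathlib

/-- The primitives of the model: each bilateral contract in the set `X` involves one agent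
(in `A`) and one institution (in `I`).  Several contracts may involve the same pair. -/
structure ContractMarket (A I X : Type*) where
  /-- the agent of a contract -/
  agent : X → A
  /-- the institution of a contract -/
  institution : X → I

namespace ContractMarket

variable {A I X : Type*} (M : ContractMarket A I X)

/-- The set of all contracts of agent `a`. -/
abbrev AgentContract (a : A) : Type _ := {x : X // M.agent x = a}

/-- The set of all contracts of institution `i`. -/
abbrev InstContract (i : I) : Type _ := {x : X // M.institution x = i}

/-! ### Preferences and matching problems -/

/-- A preference relation of agent `a`: a linear order over the contracts of `a` together with
the null contract `none`.  `rel u v` means that `u` is at least as good as `v`. -/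
structure Preference (a : A) where
  /-- the weak preference relation -/
  rel : Option (M.AgentContract a) → Option (M.AgentContract a) → Prop
  total : ∀ u v, rel u v ∨ rel v u
  antisymm : ∀ u v, rel u v → rel v u → u = v
  trans : ∀ u v w, rel u v → rel v w → rel u w

namespace Preference

variable {M} {a : A} (P : M.Preference a)

/-- Strict preference. -/
def strict (u v : Option (M.AgentContract a)) : Prop := P.rel u v ∧ u ≠ v

/-- A contract is acceptable if it is at least as good as the null contract. -/
def Acceptable (x : M.AgentContract a) : Prop := P.rel (some x) none

/-- `y` is the most preferred acceptable contract. -/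
def IsMostPreferred (y : M.AgentContract a) : Prop :=
  P.Acceptable y ∧ ∀ z, P.Acceptable z → P.rel (some y) (some z)

/-- `y` is the next most preferred acceptable contract after `x`. -/
def IsNextAfter (x y : M.AgentContract a) : Prop :=
  P.Acceptable y ∧ P.strict (some x) (some y) ∧
    ∀ z, P.Acceptable z → P.strict (some x) (some z) → P.rel (some y) (some z)

end Preference

/-- A matching problem: a profile of preference relations. -/
abbrev Problem : Type _ := ∀ a : A, M.Preference a

/-! ### Choice rules and punctual choice axioms -/

/-- A choice rule of institution `i`. -/
structure ChoiceRule (i : I) where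
  /-- the set chosen from each choice problem -/
  choice : Set (M.InstContract i) → Set (M.InstContract i)
  choice_subset : ∀ Y, choice Y ⊆ Y

/-- A punctual choice axiom for institution `i`: a correspondence that assigns to each choice
problem `Y` a collection (possibly empty) of subsets of `Y`. -/
structure PunctualAxiom (i : I) where
  /-- the collection of admissible choices at each choice problem -/
  corr : Set (M.InstContract i) → Set (Set (M.InstContract i))
  subset_of_mem : ∀ Y, ∀ Z ∈ corr Y, Z ⊆ Y

namespace ChoiceRule

variable {M} {i : I} (c : M.ChoiceRule i)

/-- Path independence. -/
def PathIndependent : Prop :=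
  ∀ Y Z : Set (M.InstContract i), c.choice (Y ∪ Z) = c.choice (c.choice Y ∪ Z)

/-- Size monotonicity (the law of aggregate demand). -/
def SizeMonotonic : Prop :=
  ∀ Y Z : Set (M.InstContract i), Y ⊆ Z → (c.choice Y).ncard ≤ (c.choice Z).ncard

/-- A choice rule satisfies a punctual axiom if it is a selection from the correspondence. -/
def Satisfies (φ : M.PunctualAxiom i) : Prop :=
  ∀ Y : Set (M.InstContract i), c.choice Y ∈ φ.corr Y

/-- `c` is characterized by the set `Φ` of punctual axioms: it is the unique choice rule that
satisfies all axioms in `Φ`. -/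
def IsCharacterizedBy (Φ : Set (M.PunctualAxiom i)) : Prop :=
  (∀ φ ∈ Φ, c.Satisfies φ) ∧ ∀ c' : M.ChoiceRule i, (∀ φ ∈ Φ, c'.Satisfies φ) → c' = c

end ChoiceRule

/-! ### Matchings and matching rules -/

/-- A set of contracts is a matching if it contains at most one contract of each agent. -/
def IsMatching (S : Set X) : Prop := ∀ a : A, {x ∈ S | M.agent x = a}.Subsingleton

/-- Matchings. -/
structure Matching where
  /-- the contracts of the matching -/
  contracts : Set X
  isMatching : M.IsMatching contracts

/-- The contracts of institution `i` that belong to the set `S`. -/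
def restrict (S : Set X) (i : I) : Set (M.InstContract i) := {x | x.1 ∈ S}

namespace Matching

variable {M} (μ : M.Matching)

open Classical in
/-- The assignment of agent `a` at a matching: the only contract of `a` in the matching, or the
null contract if there is none. -/
noncomputable def assignment (a : A) : Option (M.AgentContract a) :=
  if h : ∃ x : M.AgentContract a, x.1 ∈ μ.contracts then some h.choose else none

/-- The demand for institution `i` at a matching: the contracts of `i` that their agent finds at
least as good as her assignment. -/
def demand (R : M.Problem) (i : I) : Set (M.InstContract i) :=
  {x | (R (M.agent x.1)).rel (some ⟨x.1, rfl⟩) (μ.assignment (M.agent x.1))}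

/-- Individual rationality of a matching. -/
def IndividuallyRational (R : M.Problem) : Prop :=
  ∀ a : A, (R a).rel (μ.assignment a) none

/-- The extension of a punctual choice axiom to matchings. -/
def SatisfiesExtension (R : M.Problem) {i : I} (φ : M.PunctualAxiom i) : Prop :=
  M.restrict μ.contracts i ∈ φ.corr (μ.demand R i)

end Matching

/-- A matching rule assigns a matching to each matching problem. -/
def MatchingRule : Type _ := M.Problem → M.Matching

namespace MatchingRule

variable {M} (f : M.MatchingRule)

/-- Individual rationality of a matching rule. -/
def IndividuallyRational : Prop := ∀ R : M.Problem, (f R).IndividuallyRational R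

/-- The extension of a punctual choice axiom, for matching rules. -/
def SatisfiesExtension {i : I} (φ : M.PunctualAxiom i) : Prop :=
  ∀ R : M.Problem, (f R).SatisfiesExtension R φ

open Classical in
/-- Strategy-proofness: no agent gains by misreporting her preference relation. -/
def StrategyProof : Prop :=
  ∀ (R : M.Problem) (a : A) (R' : M.Preference a),
    (R a).rel ((f R).assignment a) ((f (Function.update R a R')).assignment a)

end MatchingRule

/-! ### The deferred-acceptance algorithm -/

section DeferredAcceptance

variable (C : ∀ i : I, M.ChoiceRule i) (R : M.Problem)

/-- If `S` is the set of contracts considered by the institutions at a step, these are the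
contracts that are (tentatively) accepted at this step. -/
def accepted (S : Set X) : Set X :=
  {x | (⟨x, rfl⟩ : M.InstContract (M.institution x)) ∈
    (C (M.institution x)).choice (M.restrict S (M.institution x))}

/-- The contracts that are rejected when `S` is considered. -/
def rejected (S : Set X) : Set X := S \ M.accepted C S

/-- The first proposals: each agent proposes her most preferred acceptable contract, if any. -/
def firstProposals : Set X :=
  {y | (R (M.agent y)).IsMostPreferred ⟨y, rfl⟩}

/-- The proposals that follow the rejection of the contracts in `T`: each agent with a contract
in `T` proposes her next most preferred acceptable contract, if any. -/
def nextProposals (T : Set X) : Set X :=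
  {y | ∃ x : M.AgentContract (M.agent y), x.1 ∈ T ∧ (R (M.agent y)).IsNextAfter x ⟨y, rfl⟩}

/-- The set of contracts considered by the institutions at each step of the algorithm (steps are
numbered from `0`).  If nothing is rejected at a step, then the set no longer changes. -/
def considered : ℕ → Set X
  | 0 => M.firstProposals R
  | s + 1 => M.accepted C (considered s) ∪ M.nextProposals R (M.rejected C (considered s))

variable {M}

theorem accepted_subset (S : Set X) : M.accepted C S ⊆ S := by
  intro x hx
  exact (C _).choice_subset _ hx

theorem IsMatching.eq {S : Set X} (h : M.IsMatching S) {x y : X} (hx : x ∈ S) (hy : y ∈ S)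
    (hxy : M.agent x = M.agent y) : x = y :=
  h (M.agent y) ⟨hx, hxy⟩ ⟨hy, rfl⟩

theorem isMatching_considered (s : ℕ) : M.IsMatching (M.considered C R s) := by
  induction s with
  | zero =>
    rintro a x ⟨hx, rfl⟩ y ⟨hy, hxy⟩
    have hx' : (R (M.agent x)).IsMostPreferred ⟨x, rfl⟩ := hx
    have hy' : (R (M.agent x)).IsMostPreferred ⟨y, hxy⟩ := by
      have : ∀ a (h : M.agent y = a), (R a).IsMostPreferred ⟨y, h⟩ := by
        rintro _ rfl; exact hy
      exact this _ hxy
    have := (R (M.agent x)).antisymm _ _ (hx'.2 _ hy'.1) (hy'.2 _ hx'.1)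
    simpa using this
  | succ s ih =>
    have key : ∀ x y : X, M.agent y = M.agent x → x ∈ M.accepted C (M.considered C R s) →
        y ∉ M.nextProposals R (M.rejected C (M.considered C R s)) := by
      rintro x y hxy hx ⟨z, hz, -⟩
      have : z.1 = x := ih.eq hz.1 (accepted_subset C _ hx) (z.2.trans hxy)
      exact hz.2 (this ▸ hx)
    rintro a x ⟨hx, rfl⟩ y ⟨hy, hxy⟩
    rcases hx with hx | hx <;> rcases hy with hy | hy
    · exact ih.eq (accepted_subset C _ hx) (accepted_subset C _ hy) hxy.symm
    · exact absurd hy (key x y hxy hx)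
    · exact absurd hx (key y x hxy.symm hy)
    · obtain ⟨z, hz, hzx⟩ := hx
      have hy' : ∃ w : M.AgentContract (M.agent x),
          w.1 ∈ M.rejected C (M.considered C R s) ∧
            (R (M.agent x)).IsNextAfter w ⟨y, hxy⟩ := by
        have : ∀ a (h : M.agent y = a), ∃ w : M.AgentContract a,
            w.1 ∈ M.rejected C (M.considered C R s) ∧ (R a).IsNextAfter w ⟨y, h⟩ := by
          rintro _ rfl; exact hy
        exact this _ hxy
      obtain ⟨w, hw, hwy⟩ := hy'
      have hwz : w = z := Subtype.ext (ih.eq hw.1 hz.1 (w.2.trans z.2.symm))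
      subst hwz
      have := (R (M.agent x)).antisymm _ _ (hzx.2.2 _ hwy.1 hwy.2.1) (hwy.2.2 _ hzx.1 hzx.2.1)
      simpa using this

/-- The algorithm stops: at some step nothing is rejected. -/
theorem exists_rejected_eq_empty [Finite X] :
    ∃ s, M.rejected C (M.considered C R s) = ∅ := by
  by_contra! hne
  -- the contracts that are at most as good for their agent as her contract in the set `S`
  let B : Set X → Set X := fun S =>
    {z | ∃ x : M.AgentContract (M.agent z), x.1 ∈ S ∧ (R (M.agent z)).rel (some x) (some ⟨z, rfl⟩)}
  have hdec : ∀ s, (B (M.considered C R (s + 1))).ncard < (B (M.considered C R s)).ncard := by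
    intro s
    have hm := isMatching_considered C R s
    obtain ⟨r, hr⟩ := hne s
    apply Set.ncard_lt_ncard _ (Set.toFinite _)
    refine ⟨?_, fun hsub => ?_⟩
    · rintro z ⟨x, hx, hxz⟩
      rcases hx with hx | hx
      · exact ⟨x, accepted_subset C _ hx, hxz⟩
      · obtain ⟨x, hxa⟩ := x
        have : ∀ a (h : M.agent x = a), ∃ w : M.AgentContract a,
            w.1 ∈ M.rejected C (M.considered C R s) ∧ (R a).IsNextAfter w ⟨x, h⟩ := by
          rintro _ rfl; exact hx
        obtain ⟨w, hw, hwx⟩ := this _ hxa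
        exact ⟨w, hw.1, (R _).trans _ _ _ hwx.2.1.1 hxz⟩
    · have hrB : r ∈ B (M.considered C R s) :=
        ⟨⟨r, rfl⟩, hr.1, ((R _).total _ _).elim id id⟩
      obtain ⟨⟨x, hxa⟩, hx, hxr⟩ := hsub hrB
      rcases hx with hx | hx
      · have : x = r := hm.eq (accepted_subset C _ hx) hr.1 hxa
        exact hr.2 (this ▸ hx)
      · have : ∀ a (h : M.agent x = a), ∃ w : M.AgentContract a,
            w.1 ∈ M.rejected C (M.considered C R s) ∧ (R a).IsNextAfter w ⟨x, h⟩ := by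
          rintro _ rfl; exact hx
        obtain ⟨w, hw, hwx⟩ := this _ hxa
        have hwr : w = ⟨r, rfl⟩ := Subtype.ext (hm.eq hw.1 hr.1 w.2)
        subst hwr
        exact hwx.2.1.2 ((R _).antisymm _ _ hwx.2.1.1 hxr)
  have hbound : ∀ s, (B (M.considered C R s)).ncard + s ≤ (B (M.considered C R 0)).ncard := by
    intro s
    induction s with
    | zero => simp
    | succ s ih => have := hdec s; omega
  have := hbound ((B (M.considered C R 0)).ncard + 1)
  omega

variable (M)

open Classical in
/-- The deferred-acceptance rule based on `C`: at each problem, the contracts that are accepted at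
the first step at which nothing is rejected. -/
noncomputable def deferredAcceptance [Finite X] : M.MatchingRule := fun R =>
  { contracts := M.accepted C (M.considered C R (Nat.find (exists_rejected_eq_empty C R)))
    isMatching := fun a _ hx _ hy =>
      isMatching_considered C R _ a ⟨accepted_subset C _ hx.1, hx.2⟩
        ⟨accepted_subset C _ hy.1, hy.2⟩ }

end DeferredAcceptance

end ContractMarket

/-! Axioms are punctual, so a unique solution must be unique problem by problem: changing the choice
at a single `Y` would otherwise give a second rule. Hence individual rationality together with the
extensions means exactly that the matching is stable, i.e. that each institution chooses its
contracts from its demand (`forall_satisfiesExtension_iff`). Path independence makes deferred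
acceptance stable, with demands contained in those of every stable matching, so it is optimal for
the agents. Size monotonicity then bounds its number of contracts by that of any stable matching,
while optimality gives the reverse inclusion of matched agents. This is the rural hospitals theorem
(`assignment_ne_none_iff`). Strategy-proofness and uniqueness both come from reports that shorten an
agent's list of acceptable contracts. A stable matching that gives her `x` stays stable when she
reports only `x` (`update_singleton`), and by rural hospitals every stable matching then gives her
`x`. -/

namespace ContractMarket

variable {A I X : Type*} {M : ContractMarket A I X}

/-! ### Path independent choice -/

namespace ChoiceRule

variable {i : I} {c : M.ChoiceRule i}

/-- Path independence implies the irrelevance of rejected contracts. -/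
theorem PathIndependent.choice_eq (h : c.PathIndependent) {Y Z : Set (M.InstContract i)}
    (h1 : c.choice Z ⊆ Y) (h2 : Y ⊆ Z) : c.choice Y = c.choice Z := by
  have := h Z Y
  rw [Set.union_eq_left.2 h2, Set.union_eq_right.2 h1] at this
  exact this.symm

/-- Path independence implies substitutability. -/
theorem PathIndependent.mem_choice_of_subset (h : c.PathIndependent)
    {Y Z : Set (M.InstContract i)} (hYZ : Y ⊆ Z) {x : M.InstContract i} (hx : x ∈ Y)
    (hxZ : x ∈ c.choice Z) : x ∈ c.choice Y := by
  -- The choice from `Z` is the choice from `c.choice Y ∪ (Z \ Y)`, so a chosen element of `Y` has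
  -- survived the choice from `Y`.
  have := h Y (Z \ Y)
  rw [Set.union_sdiff_cancel hYZ] at this
  rw [this] at hxZ
  rcases c.choice_subset _ hxZ with h' | h'
  · exact h'
  · exact absurd hx h'.2

/-- If a choice rule is characterized by punctual axioms, then at each choice problem its choice
is the only set admitted by all of them. -/
theorem IsCharacterizedBy.forall_mem_corr_iff {Φ : Set (M.PunctualAxiom i)}
    (h : c.IsCharacterizedBy Φ) {Y Z : Set (M.InstContract i)} (hZ : Z ⊆ Y) :
    (∀ φ ∈ Φ, Z ∈ φ.corr Y) ↔ Z = c.choice Y := by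
  classical
  refine ⟨fun hΦ => ?_, fun hc φ hφ => hc ▸ h.1 φ hφ Y⟩
  -- Replacing the choice at the single problem `Y` by `Z` violates no axiom, since each axiom
  -- constrains one problem at a time.
  let c' : M.ChoiceRule i :=
    { choice := Function.update c.choice Y Z
      choice_subset := fun W => by
        rcases eq_or_ne W Y with rfl | hW
        · rwa [Function.update_self]
        · rw [Function.update_of_ne hW]
          exact c.choice_subset W }
  have hc' : c' = c := h.2 c' fun φ hφ W => by
    change Function.update c.choice Y Z W ∈ φ.corr W
    rcases eq_or_ne W Y with rfl | hW
    · rw [Function.update_self]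
      exact hΦ φ hφ
    · rw [Function.update_of_ne hW]
      exact h.1 φ hφ W
  rw [← hc']
  exact (Function.update_self Y Z c.choice).symm

end ChoiceRule

/-! ### The joint choice of all institutions -/

variable {C : ∀ i : I, M.ChoiceRule i}

theorem restrict_mono {S T : Set X} (h : S ⊆ T) (i : I) : M.restrict S i ⊆ M.restrict T i :=
  fun _ hx => h hx

theorem restrict_accepted (S : Set X) (i : I) :
    M.restrict (M.accepted C S) i = (C i).choice (M.restrict S i) := by
  ext ⟨x, rfl⟩
  rfl

theorem eq_of_restrict_eq {S T : Set X} (h : ∀ i, M.restrict S i = M.restrict T i) : S = T := by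
  ext x
  exact Set.ext_iff.1 (h (M.institution x)) ⟨x, rfl⟩

theorem accepted_union (hpath : ∀ i, (C i).PathIndependent) (S T : Set X) :
    M.accepted C (S ∪ T) = M.accepted C (M.accepted C S ∪ T) := by
  refine eq_of_restrict_eq (M := M) fun i => ?_
  rw [restrict_accepted, restrict_accepted]
  refine (hpath i (M.restrict S i) (M.restrict T i)).trans ?_
  rw [← restrict_accepted]
  rfl

theorem accepted_eq_of_subset (hpath : ∀ i, (C i).PathIndependent) {S T : Set X}
    (h1 : M.accepted C T ⊆ S) (h2 : S ⊆ T) : M.accepted C S = M.accepted C T := by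
  refine eq_of_restrict_eq (M := M) fun i => ?_
  rw [restrict_accepted, restrict_accepted]
  refine (hpath i).choice_eq ?_ (restrict_mono h2 i)
  rw [← restrict_accepted]
  exact restrict_mono h1 i

theorem mem_accepted_of_subset (hpath : ∀ i, (C i).PathIndependent) {S T : Set X} (hST : S ⊆ T)
    {x : X} (hx : x ∈ S) (hxT : x ∈ M.accepted C T) : x ∈ M.accepted C S :=
  (hpath _).mem_choice_of_subset (restrict_mono hST _) hx hxT

theorem ncard_accepted_le [Finite X] (hsize : ∀ i, (C i).SizeMonotonic) {S T : Set X}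
    (hST : S ⊆ T) : (M.accepted C S).ncard ≤ (M.accepted C T).ncard := by
  classical
  have := Fintype.ofFinite X
  -- `I` may be infinite, so the sum runs over the finitely many institutions that have a contract.
  have key : ∀ U : Set X, (M.accepted C U).ncard =
      ∑ i ∈ Finset.univ.image M.institution, ((C i).choice (M.restrict U i)).ncard := by
    intro U
    rw [Set.ncard_eq_toFinset_card', Finset.card_eq_sum_card_fiberwise
      (f := M.institution) (t := Finset.univ.image M.institution) (by intro; simp)]
    refine Finset.sum_congr rfl fun i _ => ?_
    rw [← restrict_accepted, ← Set.ncard_coe_finset,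
      ← Set.ncard_image_of_injective _ Subtype.val_injective]
    congr 1
    ext x
    simp [restrict, and_comm]
  rw [key, key]
  exact Finset.sum_le_sum fun i _ => hsize i _ _ (restrict_mono hST i)

/-! ### Preferences -/

namespace Preference

variable {a : A} (P : M.Preference a)

theorem refl (u : Option (M.AgentContract a)) : P.rel u u := (P.total u u).elim id id

variable {P} in
theorem strict.not_rel {u v : Option (M.AgentContract a)} (h : P.strict u v) : ¬ P.rel v u :=
  fun h' => h.2 (P.antisymm _ _ h.1 h')

theorem strict_of_not_rel {u v : Option (M.AgentContract a)} (h : ¬ P.rel u v) : P.strict v u :=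
  ⟨(P.total v u).resolve_right h, fun e => h (e ▸ P.refl v)⟩

theorem exists_best [Finite X] {S : Set (M.AgentContract a)} (hS : S.Nonempty) :
    ∃ y ∈ S, ∀ z ∈ S, P.rel (some y) (some z) := by
  -- Larger means preferred, so a maximal element of a finite set is a best one by totality.
  let _ : Preorder (M.AgentContract a) :=
    { le := fun y z => P.rel (some z) (some y)
      le_refl := fun y => P.refl _
      le_trans := fun _ _ _ h h' => P.trans _ _ _ h' h }
  obtain ⟨y, hy⟩ := (Set.toFinite S).exists_maximal hS
  refine ⟨y, hy.1, fun z hz => ?_⟩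
  by_contra hne
  exact hne (hy.2 hz ((P.total _ _).resolve_left hne))

theorem exists_isMostPreferred [Finite X] {x : M.AgentContract a} (hx : P.Acceptable x) :
    ∃ y, P.IsMostPreferred y :=
  (P.exists_best (S := {y | P.Acceptable y}) ⟨x, hx⟩).imp fun _ h => h

theorem exists_isNextAfter [Finite X] {x z : M.AgentContract a} (hx : P.Acceptable x)
    (hzx : P.strict (some z) (some x)) : ∃ y, P.IsNextAfter z y := by
  obtain ⟨y, hy, hbest⟩ :=
    P.exists_best (S := {y | P.Acceptable y ∧ P.strict (some z) (some y)}) ⟨x, hx, hzx⟩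
  exact ⟨y, hy.1, hy.2, fun w hw hw' => hbest w ⟨hw, hw'⟩⟩

open Classical in
/-- The position of an assignment relative to the null contract if exactly the contracts in `K`
are acceptable. -/
noncomputable def tier (K : Set (M.AgentContract a)) : Option (M.AgentContract a) → ℕ
  | none => 1
  | some x => if x ∈ K then 2 else 0

/-- The preference relation that makes exactly the contracts in `K` acceptable and otherwise
ranks them as `P` does. -/
def restrictAcceptable (K : Set (M.AgentContract a)) : M.Preference a where
  -- Lexicographic: tiers first, `P` within a tier.
  rel u v := tier K v < tier K u ∨ tier K v = tier K u ∧ P.rel u v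
  total u v := by
    rcases lt_trichotomy (tier K u) (tier K v) with h | h | h
    · exact .inr (.inl h)
    · exact (P.total u v).imp (fun h' => .inr ⟨h.symm, h'⟩) (fun h' => .inr ⟨h, h'⟩)
    · exact .inl (.inl h)
  antisymm u v h h' := by
    rcases h with h | h <;> rcases h' with h' | h'
    · omega
    · omega
    · omega
    · exact P.antisymm _ _ h.2 h'.2
  trans u v w h h' := by
    rcases h with h | h <;> rcases h' with h' | h'
    · exact .inl (h'.trans h)
    · exact .inl (h'.1 ▸ h)
    · exact .inl (h.1 ▸ h')
    · exact .inr ⟨h'.1.trans h.1, P.trans _ _ _ h.2 h'.2⟩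

variable {K : Set (M.AgentContract a)} {x y : M.AgentContract a}

theorem restrictAcceptable_rel_none : (P.restrictAcceptable K).rel (some x) none ↔ x ∈ K := by
  by_cases h : x ∈ K <;> simp [restrictAcceptable, tier, h]

theorem mem_of_restrictAcceptable_rel (hx : x ∈ K)
    (h : (P.restrictAcceptable K).rel (some y) (some x)) : y ∈ K :=
  P.restrictAcceptable_rel_none.1
    ((P.restrictAcceptable K).trans _ _ _ h (P.restrictAcceptable_rel_none.2 hx))

theorem restrictAcceptable_rel_of_mem (hx : x ∈ K) (hy : y ∈ K) (h : P.rel (some x) (some y)) :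
    (P.restrictAcceptable K).rel (some x) (some y) :=
  .inr ⟨by simp [tier, hx, hy], h⟩

end Preference

/-! ### Stable matchings -/

namespace Matching

theorem assignment_eq_some_iff {μ : M.Matching} {a : A} {x : M.AgentContract a} :
    μ.assignment a = some x ↔ x.1 ∈ μ.contracts := by
  unfold assignment
  split_ifs with h
  · rw [Option.some_inj]
    refine ⟨fun e => e ▸ h.choose_spec, fun hx => Subtype.ext ?_⟩
    exact μ.isMatching.eq h.choose_spec hx (h.choose.2.trans x.2.symm)
  · simp only [false_iff]
    exact fun hx => h ⟨x, hx⟩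

theorem ext_assignment {μ ν : M.Matching} (h : ∀ a, μ.assignment a = ν.assignment a) :
    μ = ν := by
  have : μ.contracts = ν.contracts := by
    ext x
    rw [← assignment_eq_some_iff (μ := μ) (x := ⟨x, rfl⟩), h, assignment_eq_some_iff]
  cases μ
  cases ν
  cases this
  rfl

/-- The contracts that their agent finds at least as good as her assignment. -/
def demandSet (μ : M.Matching) (R : M.Problem) : Set X :=
  {x | (R (M.agent x)).rel (some ⟨x, rfl⟩) (μ.assignment (M.agent x))}

theorem mem_demandSet {μ : M.Matching} {R : M.Problem} {a : A} {x : M.AgentContract a} :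
    x.1 ∈ μ.demandSet R ↔ (R a).rel (some x) (μ.assignment a) := by
  obtain ⟨x, rfl⟩ := x
  rfl

theorem restrict_demandSet (μ : M.Matching) (R : M.Problem) (i : I) :
    M.restrict (μ.demandSet R) i = μ.demand R i := rfl

theorem contracts_subset_demandSet (μ : M.Matching) (R : M.Problem) :
    μ.contracts ⊆ μ.demandSet R := fun x hx => by
  have h : μ.assignment (M.agent x) = some ⟨x, rfl⟩ := assignment_eq_some_iff.2 hx
  change (R (M.agent x)).rel _ _
  rw [h]
  exact (R _).refl _

/-- A matching is stable if it is individually rational and each institution chooses its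
contracts from its demand. -/
def IsStable (C : ∀ i : I, M.ChoiceRule i) (R : M.Problem) (μ : M.Matching) : Prop :=
  μ.IndividuallyRational R ∧ M.accepted C (μ.demandSet R) = μ.contracts

/-- For choice rules that are characterized by punctual axioms, the extensions of the axioms
say that each institution chooses its contracts from its demand. -/
theorem forall_satisfiesExtension_iff {Φ : ∀ i : I, Set (M.PunctualAxiom i)}
    (hchar : ∀ i : I, (C i).IsCharacterizedBy (Φ i)) (μ : M.Matching) (R : M.Problem) :
    (∀ i, ∀ φ ∈ Φ i, μ.SatisfiesExtension R φ) ↔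
      M.accepted C (μ.demandSet R) = μ.contracts := by
  have key : ∀ i, (∀ φ ∈ Φ i, μ.SatisfiesExtension R φ) ↔
      M.restrict μ.contracts i = M.restrict (M.accepted C (μ.demandSet R)) i := fun i => by
    rw [restrict_accepted, restrict_demandSet]
    exact (hchar i).forall_mem_corr_iff (restrict_mono (μ.contracts_subset_demandSet R) i)
  simp only [key]
  exact ⟨fun h => (eq_of_restrict_eq h).symm, fun h i => by rw [h]⟩

open Classical in
/-- Stability is preserved if the preference relation of one agent changes in such a way that
she demands no new contracts. -/
theorem IsStable.update (hpath : ∀ i, (C i).PathIndependent) {R : M.Problem} {a : A}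
    {P P' : M.Preference a} {μ : M.Matching} (h : μ.IsStable C (Function.update R a P))
    (hir : P'.rel (μ.assignment a) none)
    (hdem : ∀ y, P'.rel (some y) (μ.assignment a) → P.rel (some y) (μ.assignment a)) :
    μ.IsStable C (Function.update R a P') := by
  refine ⟨fun b => ?_, ?_⟩
  · rcases eq_or_ne b a with rfl | hb
    · rwa [Function.update_self]
    · have := h.1 b
      rwa [Function.update_of_ne hb] at this ⊢
  · rw [← h.2]
    -- The new demand lies between `μ.contracts` and the old demand, so only rejected contracts
    -- disappear.
    refine accepted_eq_of_subset hpath ?_ fun x hx => ?_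
    · rw [h.2]
      exact μ.contracts_subset_demandSet _
    · obtain ⟨b, hb⟩ : ∃ b, M.agent x = b := ⟨_, rfl⟩
      have hx' := (mem_demandSet (x := ⟨x, hb⟩)).1 hx
      refine (mem_demandSet (x := ⟨x, hb⟩)).2 ?_
      rcases eq_or_ne b a with rfl | hne
      · rw [Function.update_self] at hx' ⊢
        exact hdem _ hx'
      · rwa [Function.update_of_ne hne] at hx' ⊢

open Classical in
/-- A stable matching remains stable if an agent reports that her contract in it is the only
acceptable one. -/
theorem IsStable.update_singleton (hpath : ∀ i, (C i).PathIndependent) {R : M.Problem} {a : A}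
    {P P' : M.Preference a} {μ : M.Matching} (h : μ.IsStable C (Function.update R a P))
    {x : M.AgentContract a} (hx : μ.assignment a = some x) :
    μ.IsStable C (Function.update R a (P'.restrictAcceptable {x})) := by
  refine h.update hpath ?_ fun y hy => ?_
  · rw [hx]
    exact P'.restrictAcceptable_rel_none.2 rfl
  · rw [hx] at hy ⊢
    have : y = x := P'.mem_of_restrictAcceptable_rel (K := {x}) rfl hy
    rw [this]
    exact P.refl _

/-- A stable matching with the smallest demands is optimal for the agents. -/
theorem IsStable.rel_of_demandSet_subset (hpath : ∀ i, (C i).PathIndependent) {R : M.Problem}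
    {μ ν : M.Matching} (hμ : μ.IsStable C R) (hν : ν.IsStable C R)
    (h : μ.demandSet R ⊆ ν.demandSet R) (a : A) :
    (R a).rel (μ.assignment a) (ν.assignment a) := by
  cases hx : ν.assignment a with
  | none => exact hμ.1 a
  | some x =>
    rcases (R a).total (μ.assignment a) (some x) with h' | h'
    · exact h'
    · have hxμ : x.1 ∈ μ.contracts := by
        rw [← hμ.2]
        refine mem_accepted_of_subset hpath h (mem_demandSet.2 h') ?_
        rw [hν.2]
        exact assignment_eq_some_iff.1 hx
      rw [assignment_eq_some_iff.2 hxμ]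
      exact (R a).refl _

/-- The rural hospitals theorem, for a stable matching that is optimal for the agents: agents
that it matches are matched in every stable matching. -/
theorem IsStable.assignment_ne_none [Finite X] (hsize : ∀ i, (C i).SizeMonotonic)
    {R : M.Problem} {μ ν : M.Matching} (hμ : μ.IsStable C R) (hν : ν.IsStable C R)
    (hopt : ∀ a, (R a).rel (μ.assignment a) (ν.assignment a)) {a : A}
    (ha : μ.assignment a ≠ none) : ν.assignment a ≠ none := by
  have hsub : μ.demandSet R ⊆ ν.demandSet R := fun x hx =>
    (R _).trans _ _ _ hx (hopt _)
  have hcard := ncard_accepted_le hsize hsub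
  rw [hμ.2, hν.2] at hcard
  have himage : ∀ κ : M.Matching, (M.agent '' κ.contracts).ncard = κ.contracts.ncard :=
    fun κ => Set.InjOn.ncard_image fun x hx y hy hxy => κ.isMatching.eq hx hy hxy
  have hagents : M.agent '' ν.contracts ⊆ M.agent '' μ.contracts := by
    rintro _ ⟨x, hx, rfl⟩
    cases hm : μ.assignment (M.agent x) with
    | none =>
      have h1 := hopt (M.agent x)
      have h2 := hν.1 (M.agent x)
      have h3 : ν.assignment (M.agent x) = some ⟨x, rfl⟩ := assignment_eq_some_iff.2 hx
      rw [hm, h3] at h1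
      rw [h3] at h2
      exact absurd ((R _).antisymm _ _ h1 h2) (by simp)
    | some y => exact ⟨y.1, assignment_eq_some_iff.1 hm, y.2⟩
  -- `ν` has at least as many contracts as `μ`, hence at least as many matched agents, so the
  -- inclusion is an equality.
  have heq : M.agent '' ν.contracts = M.agent '' μ.contracts :=
    Set.eq_of_subset_of_ncard_le hagents (by rwa [himage, himage]) (Set.toFinite _)
  obtain ⟨x, hx⟩ := Option.ne_none_iff_exists'.1 ha
  have : a ∈ M.agent '' ν.contracts := heq ▸ ⟨x.1, assignment_eq_some_iff.1 hx, x.2⟩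
  obtain ⟨y, hy, hya⟩ := this
  rw [assignment_eq_some_iff (x := ⟨y, hya⟩) |>.2 hy]
  simp

end Matching

/-! ### Deferred acceptance -/

section DeferredAcceptance

variable {R : M.Problem}

theorem mem_firstProposals {a : A} {x : M.AgentContract a} :
    x.1 ∈ M.firstProposals R ↔ (R a).IsMostPreferred x := by
  obtain ⟨x, rfl⟩ := x
  rfl

theorem mem_nextProposals {T : Set X} {a : A} {y : M.AgentContract a} :
    y.1 ∈ M.nextProposals R T ↔
      ∃ x : M.AgentContract a, x.1 ∈ T ∧ (R a).IsNextAfter x y := by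
  obtain ⟨y, rfl⟩ := y
  rfl

variable (C R) in
/-- The contracts that have been proposed up to step `s`. -/
def proposed : ℕ → Set X
  | 0 => M.considered C R 0
  | s + 1 => proposed s ∪ M.considered C R (s + 1)

theorem considered_subset_proposed (s : ℕ) : M.considered C R s ⊆ proposed C R s := by
  cases s with
  | zero => exact subset_rfl
  | succ s => exact Set.subset_union_right

/-- Contracts rejected earlier can be put back without effect: path independence replaces the past
proposals by the contracts held from them, which are considered again at the next step. The
algorithm thus chooses from cumulative offers. -/
theorem accepted_proposed (hpath : ∀ i, (C i).PathIndependent) (s : ℕ) :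
    M.accepted C (proposed C R s) = M.accepted C (M.considered C R s) := by
  induction s with
  | zero => rfl
  | succ s ih =>
    rw [proposed, accepted_union hpath, ih]
    congr 1
    exact Set.union_eq_right.2 Set.subset_union_left

theorem acceptable_of_mem_proposed {a : A} {x : M.AgentContract a} {s : ℕ}
    (hx : x.1 ∈ proposed C R s) : (R a).Acceptable x := by
  induction s with
  | zero => exact (mem_firstProposals.1 hx).1
  | succ s ih =>
    rcases hx with hx | hx | hx
    · exact ih hx
    · exact ih (considered_subset_proposed s (accepted_subset C _ hx))
    · obtain ⟨z, -, hz⟩ := mem_nextProposals.1 hx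
      exact hz.1

/-- Agents propose in the order of their preferences. -/
theorem rel_of_mem_proposed {a : A} {x y : M.AgentContract a} {s : ℕ}
    (hx : x.1 ∈ proposed C R s) (hy : y.1 ∈ M.considered C R s) :
    (R a).rel (some x) (some y) := by
  induction s generalizing x y with
  | zero => exact (mem_firstProposals.1 hx).2 y (mem_firstProposals.1 hy).1
  | succ s ih =>
    rcases hx with hx | hx
    · rcases hy with hy | hy
      · exact ih hx (accepted_subset C _ hy)
      · obtain ⟨z, hz, hzy⟩ := mem_nextProposals.1 hy
        exact (R a).trans _ _ _ (ih hx hz.1) hzy.2.1.1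
    · have : x = y :=
        Subtype.ext ((isMatching_considered C R (s + 1)).eq hx hy (x.2.trans y.2.symm))
      rw [this]
      exact (R a).refl _

/-- No acceptable contract is skipped. -/
theorem mem_proposed_or_exists_strict [Finite X] {a : A} {x : M.AgentContract a}
    (hx : (R a).Acceptable x) (s : ℕ) :
    x.1 ∈ proposed C R s ∨
      ∃ y : M.AgentContract a, y.1 ∈ M.considered C R s ∧ (R a).strict (some y) (some x) := by
  induction s with
  | zero =>
    obtain ⟨y, hy⟩ := (R a).exists_isMostPreferred hx
    rcases eq_or_ne y x with rfl | hne
    · exact .inl (mem_firstProposals.2 hy)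
    · exact .inr ⟨y, mem_firstProposals.2 hy, hy.2 x hx, by simpa using hne⟩
  | succ s ih =>
    rcases ih with ih | ⟨z, hz, hzx⟩
    · exact .inl (.inl ih)
    · by_cases hacc : z.1 ∈ M.accepted C (M.considered C R s)
      · exact .inr ⟨z, .inl hacc, hzx⟩
      -- As `x` is itself a candidate to follow `z`, the next proposal `y` is at least as good as
      -- `x`.
      · obtain ⟨y, hy⟩ := (R a).exists_isNextAfter hx hzx
        have hmem : y.1 ∈ M.considered C R (s + 1) :=
          .inr (mem_nextProposals.2 ⟨z, ⟨hz, hacc⟩, hy⟩)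
        rcases eq_or_ne y x with rfl | hne
        · exact .inl (.inr hmem)
        · exact .inr ⟨y, hmem, hy.2.2 x hx hzx, by simpa using hne⟩

/-- No agent ever proposes a contract that is worse than her assignment in a given stable
matching. -/
theorem proposed_subset_demandSet (hpath : ∀ i, (C i).PathIndependent) {μ : M.Matching}
    (hμ : μ.IsStable C R) (s : ℕ) : proposed C R s ⊆ μ.demandSet R := by
  induction s with
  | zero =>
    intro y hy
    have hy' : (R (M.agent y)).IsMostPreferred ⟨y, rfl⟩ := hy
    have hir := hμ.1 (M.agent y)
    change (R (M.agent y)).rel _ _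
    cases hx : μ.assignment (M.agent y) with
    | none => exact hy'.1
    | some x =>
      rw [hx] at hir
      exact hy'.2 x hir
  | succ s ih =>
    rintro y (hy | hy | hy)
    · exact ih hy
    · exact ih (considered_subset_proposed s (accepted_subset C _ hy))
    · obtain ⟨z, hz, hzy⟩ := hy
      have hsub := (considered_subset_proposed s).trans ih
      -- By substitutability, a contract of `μ` considered within the demand at `μ` is never
      -- rejected. So `z` is strictly better than the assignment at `μ`, and the proposal after `z`
      -- cannot skip past that assignment.
      have hzμ : z.1 ∉ μ.contracts := fun h =>
        hz.2 (mem_accepted_of_subset hpath hsub hz.1 (hμ.2.symm ▸ h))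
      have hrel := Matching.mem_demandSet.1 (hsub hz.1)
      have hir := hμ.1 (M.agent y)
      change (R (M.agent y)).rel _ _
      cases hx : μ.assignment (M.agent y) with
      | none => exact hzy.1
      | some x =>
        rw [hx] at hrel hir
        refine hzy.2.2 x hir ⟨hrel, fun e => hzμ ?_⟩
        exact Matching.assignment_eq_some_iff.1 (hx.trans e.symm)

variable [Finite X]

variable (C R) in
/-- The outcome of deferred acceptance consists of the contracts considered at its last step. -/
theorem exists_deferredAcceptance_contracts_eq :
    ∃ s, (M.deferredAcceptance C R).contracts = M.considered C R s ∧
      M.accepted C (M.considered C R s) = M.considered C R s := by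
  classical
  have hs := Nat.find_spec (exists_rejected_eq_empty C R)
  have h : M.accepted C (M.considered C R (Nat.find (exists_rejected_eq_empty C R))) =
      M.considered C R (Nat.find (exists_rejected_eq_empty C R)) :=
    (accepted_subset C _).antisymm (Set.sdiff_eq_empty.1 hs)
  refine ⟨Nat.find (exists_rejected_eq_empty C R), ?_, h⟩
  refine Eq.trans ?_ h
  unfold deferredAcceptance
  congr!

variable (R) in
/-- The outcome of deferred acceptance is stable, and its demands are the smallest among all
stable matchings. -/
theorem deferredAcceptance_isStable_and_demandSet_subset (hpath : ∀ i, (C i).PathIndependent) :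
    (M.deferredAcceptance C R).IsStable C R ∧ ∀ ν : M.Matching, ν.IsStable C R →
      (M.deferredAcceptance C R).demandSet R ⊆ ν.demandSet R := by
  obtain ⟨s, hs, hacc⟩ := exists_deferredAcceptance_contracts_eq C R
  generalize M.deferredAcceptance C R = μ at hs ⊢
  have hmem : ∀ {a : A} {x : M.AgentContract a},
      μ.assignment a = some x ↔ x.1 ∈ M.considered C R s := by
    intro a x
    rw [Matching.assignment_eq_some_iff, hs]
  have hir : μ.IndividuallyRational R := fun a => by
    cases hx : μ.assignment a with
    | none => exact (R a).refl _
    | some x => exact acceptable_of_mem_proposed (considered_subset_proposed s (hmem.1 hx))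
  -- This identity gives both claims: stability through `accepted_proposed`, minimality through
  -- `proposed_subset_demandSet`.
  have hdem : μ.demandSet R = proposed C R s := by
    ext x
    refine ⟨fun hx => ?_, fun hx => ?_⟩
    · have hx' : (R (M.agent x)).rel (some ⟨x, rfl⟩) _ := hx
      rcases mem_proposed_or_exists_strict (C := C)
        ((R (M.agent x)).trans _ _ _ hx' (hir _)) s with h | ⟨y, hy, hyx⟩
      · exact h
      · rw [hmem.2 hy] at hx'
        exact absurd hx' hyx.not_rel
    · change (R (M.agent x)).rel _ _
      cases hy : μ.assignment (M.agent x) with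
      | none => exact acceptable_of_mem_proposed (x := ⟨x, rfl⟩) hx
      | some y => exact rel_of_mem_proposed (x := ⟨x, rfl⟩) hx (hmem.1 hy)
  refine ⟨⟨hir, ?_⟩, fun ν hν => hdem ▸ proposed_subset_demandSet hpath hν s⟩
  rw [hdem, accepted_proposed hpath, hacc, hs]

variable (R) in
theorem deferredAcceptance_isStable (hpath : ∀ i, (C i).PathIndependent) :
    (M.deferredAcceptance C R).IsStable C R :=
  (deferredAcceptance_isStable_and_demandSet_subset R hpath).1

/-- Every agent weakly prefers the outcome of deferred acceptance to any stable matching. -/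
theorem deferredAcceptance_rel (hpath : ∀ i, (C i).PathIndependent) {ν : M.Matching}
    (hν : ν.IsStable C R) (a : A) :
    (R a).rel ((M.deferredAcceptance C R).assignment a) (ν.assignment a) :=
  have h := deferredAcceptance_isStable_and_demandSet_subset R hpath
  h.1.rel_of_demandSet_subset hpath hν (h.2 ν hν) a

/-! ### Rural hospitals, strategy-proofness and uniqueness -/

/-- The rural hospitals theorem: all stable matchings match the same agents. -/
theorem Matching.IsStable.assignment_ne_none_iff (hpath : ∀ i, (C i).PathIndependent)
    (hsize : ∀ i, (C i).SizeMonotonic) {μ ν : M.Matching} (hμ : μ.IsStable C R)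
    (hν : ν.IsStable C R) {a : A} : μ.assignment a ≠ none ↔ ν.assignment a ≠ none := by
  have key : ∀ {κ : M.Matching}, κ.IsStable C R →
      (κ.assignment a ≠ none ↔ (M.deferredAcceptance C R).assignment a ≠ none) := by
    refine fun {κ} hκ => ⟨fun h h' => h ?_, fun h => ?_⟩
    · have := deferredAcceptance_rel hpath hκ a
      rw [h'] at this
      exact (R a).antisymm _ _ (hκ.1 a) this
    · exact (deferredAcceptance_isStable R hpath).assignment_ne_none hsize hκ
        (deferredAcceptance_rel hpath hκ) h
  rw [key hμ, key hν]

/-- Suppose a misreport yields `x`, better than the truthful outcome. Let the agent truncate her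
true list at `x`, and take a stable matching `ν` there. If `ν` matches her, it is stable at the true
preferences and beats the optimal outcome; if not, it contradicts rural hospitals at the report of
`x` alone. -/
theorem deferredAcceptance_strategyProof (hpath : ∀ i, (C i).PathIndependent)
    (hsize : ∀ i, (C i).SizeMonotonic) : (M.deferredAcceptance C).StrategyProof := by
  classical
  intro R a P'
  by_contra hne
  -- `x` is the contract that the agent obtains by misreporting
  have hstrict := (R a).strict_of_not_rel hne
  obtain ⟨x, hx⟩ : ∃ x, (M.deferredAcceptance C (Function.update R a P')).assignment a =
      some x := by
    refine Option.ne_none_iff_exists'.1 fun h => hne ?_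
    convert (deferredAcceptance_isStable R hpath).1 a using 1
  have hstrict : (R a).strict (some x) ((M.deferredAcceptance C R).assignment a) := by
    convert hstrict using 1
    rw [← hx]
  have hx0 : (R a).rel (some x) none :=
    (R a).trans _ _ _ hstrict.1 ((deferredAcceptance_isStable R hpath).1 a)
  set K : Set (M.AgentContract a) := {y | (R a).rel (some y) (some x)}
  have hxK : x ∈ K := (R a).refl _
  -- The outcome of the misreport is stable, and matches `a`, when `a` accepts only `x`.
  have hY := (deferredAcceptance_isStable (Function.update R a P') hpath).update_singleton
    hpath (P' := R a) hx
  have hZ := deferredAcceptance_isStable (Function.update R a ((R a).restrictAcceptable K)) hpath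
  generalize M.deferredAcceptance C (Function.update R a ((R a).restrictAcceptable K)) = ν at hZ
  cases hz : ν.assignment a with
  | none =>
    -- Unmatched at `ν`, the agent demands all of `K`; shrinking `K` to `{x}` only removes demands.
    have hZ' : ν.IsStable C (Function.update R a ((R a).restrictAcceptable {x})) := by
      refine hZ.update hpath ?_ fun y hy => ?_
      · rw [hz]
        exact Preference.refl _ _
      · rw [hz] at hy ⊢
        have : y = x := (R a).restrictAcceptable_rel_none (K := {x}) |>.1 hy
        rw [this]
        exact (R a).restrictAcceptable_rel_none.2 hxK
    exact (hY.assignment_ne_none_iff hpath hsize hZ').1 (by simp [hx]) hz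
  | some z =>
    have hzK : z ∈ K := by
      have := hZ.1 a
      rw [hz, Function.update_self] at this
      exact (R a).restrictAcceptable_rel_none.1 this
    -- Everything truly at least as good as `z` lies in `K`, so undoing the truncation adds no
    -- demand.
    have hZ' : ν.IsStable C (Function.update R a (R a)) := by
      refine hZ.update hpath ?_ fun y hy => ?_
      · rw [hz]
        exact (R a).trans _ _ _ hzK hx0
      · rw [hz] at hy ⊢
        exact (R a).restrictAcceptable_rel_of_mem ((R a).trans _ _ _ hy hzK) hzK hy
    rw [Function.update_eq_self] at hZ'
    have := deferredAcceptance_rel hpath hZ' a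
    rw [hz] at this
    exact hstrict.not_rel ((R a).trans _ _ _ this hzK)

/-- Deferred acceptance is the only stable and strategy-proof matching rule. -/
theorem MatchingRule.StrategyProof.eq_deferredAcceptance (hpath : ∀ i, (C i).PathIndependent)
    (hsize : ∀ i, (C i).SizeMonotonic) {f : M.MatchingRule} (hf : f.StrategyProof)
    (hstable : ∀ R, (f R).IsStable C R) : f = M.deferredAcceptance C := by
  classical
  funext R
  refine Matching.ext_assignment fun a =>
    (R a).antisymm _ _ ?_ (deferredAcceptance_rel hpath (hstable R) a)
  cases hx : (M.deferredAcceptance C R).assignment a with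
  | none => exact (hstable R).1 a
  | some x =>
    have hD := deferredAcceptance_isStable R hpath
    rw [← Function.update_eq_self a R] at hx hD
    have hD' := hD.update_singleton hpath (P' := R a) hx
    have hS := hstable (Function.update R a ((R a).restrictAcceptable {x}))
    obtain ⟨y, hy⟩ := Option.ne_none_iff_exists'.1
      ((hD'.assignment_ne_none_iff hpath hsize hS).1 (hx ▸ Option.some_ne_none x))
    have hyx : y = x := by
      have := hS.1 a
      rw [hy, Function.update_self] at this
      exact (R a).restrictAcceptable_rel_none (K := {x}) |>.1 this
    rw [hyx] at hy
    -- Reporting only `x` secures `x` under `f`, so the truthful assignment must be at least as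
    -- good.
    convert hf R a ((R a).restrictAcceptable {x}) using 1
    rw [← hy]

end DeferredAcceptance

end ContractMarket

theorem theorem1 {A I X : Type*} [Finite X] (M : ContractMarket A I X)
    (C : ∀ i : I, M.ChoiceRule i) (Φ : ∀ i : I, Set (M.PunctualAxiom i))
    (hchar : ∀ i : I, (C i).IsCharacterizedBy (Φ i))
    (hpath : ∀ i : I, (C i).PathIndependent)
    (hsize : ∀ i : I, (C i).SizeMonotonic)
    (f : M.MatchingRule) :
    (f.IndividuallyRational ∧ f.StrategyProof ∧
        ∀ i : I, ∀ φ ∈ Φ i, f.SatisfiesExtension φ) ↔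
      f = M.deferredAcceptance C := by
  constructor
  · rintro ⟨hir, hsp, hext⟩
    exact hsp.eq_deferredAcceptance hpath hsize fun R => ⟨hir R,
      (ContractMarket.Matching.forall_satisfiesExtension_iff hchar (f R) R).1
        fun i φ hφ => hext i φ hφ R⟩
  · rintro rfl
    have h := fun R => ContractMarket.deferredAcceptance_isStable (C := C) R hpath
    exact ⟨fun R => (h R).1, ContractMarket.deferredAcceptance_strategyProof hpath hsize,
      fun i φ hφ R =>
        (ContractMarket.Matching.forall_satisfiesExtension_iff hchar _ R).2 (h R).2 i φ hφ⟩
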